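/- Let $n\in\mathbb N$ and let $(M,\omega)$ be an $n$-plectic manifold, i.e. a smooth (finite-dimensional) manifold $M$ with a closed form $\omega\in\Omega^{n+1}(M)$ such that $v\mapsto\iota_v\omega_x$ is injective on $T_xM$ for every $x\in M$. Let $\mathfrak g$ be a finite-dimensional real Lie algebra and let $\zeta:\mathfrak g\to\mathfrak X(M)$ be an infinitesimal $n$-plectic action, i.e. a Lie algebra homomorphism with $\mathcal L_{\zeta(X)}\omega=0$ for all $X\in\mathfrak g$. Let $\delta$ be the Chevalley–Eilenberg differential on $\Lambda^\bullet\mathfrak g^*$ (trivial coefficients), $H^\bullet(\mathfrak g)$ its cohomology, and let $P_{\mathfrak g}=\ker(\delta^*:\Lambda^n\mathfrak g\to\Lambda^{n-1}\mathfrak g)$, where $$\delta^*(X_1\wedge\dots\wedge X_n)=\sum_{i<j}(-1)^{i+j}[X_i,X_j]\wedge X_1\wedge\dots\wedge\widehat{X_i}\wedge\dots\wedge\widehat{X_j}\wedge\dots\wedge X_n .$$ If $H^n(\mathfrak g)=0$ and $H^{n+1}(\mathfrak g)=0$, then there exists a multi-moment map in the sense of Madsen and Swann, i.e. a smooth map $v:M\to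 P_{\mathfrak g}^*$ such that the functions $\bar v(p):=\langle v,p\rangle\in C^\infty(M)$, $p\in P_{\mathfrak g}$, satisfy 1. $d(\bar v(p))=\iota_{\zeta(p)}\omega$ for all $p\in P_{\mathfrak g}$, and 2. $\bar v(\mathrm{ad}_X(p))=\mathcal L_{\zeta(X)}(\bar v(p))$ for all $X\in\mathfrak g$ and $p\in P_{\mathfrak g}$. Here, for $p=\sum_\alpha X_1^\alpha\wedge\dots\wedge X_n^\alpha$, one sets $\iota_{\zeta(p)}\omega=\sum_\alpha\iota_{\zeta(X_n^\alpha)}\cdots\iota_{\zeta(X_1^\alpha)}\omega$, and $\mathrm{ad}_X$ is the action on $\Lambda^n\mathfrak g$ induced by the adjoint representation, $\mathrm{ad}_X(X_1\wedge\dots\wedge X_n)=\sum_l X_1\wedge\dots\wedge[X,X_l]\wedge\dots\wedge X_n$ (it preserves $P_{\mathfrak g}$). -/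

import Mathlib

open scoped Manifold ContDiff

namespace MultiMoment

noncomputable section

/-! ## Lie algebra cohomology with trivial coefficients -/

section LieAlgebraCohomology

variable {𝔤 : Type*} [LieRing 𝔤] [LieAlgebra ℝ 𝔤]
variable {N : Type*} [AddCommGroup N] [Module ℝ N]

/-- Auxiliary expression of the Chevalley–Eilenberg differential as a twofold alternatization,
used to prove that the explicit formula in `ceDiffSucc` defines an alternating map. -/
def ceAux {m : ℕ} (f : 𝔤 [⋀^Fin (m + 1)]→ₗ[ℝ] N) : 𝔤 [⋀^Fin (m + 2)]→ₗ[ℝ] N :=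
  (-(1 / 2) : ℝ) • AlternatingMap.alternatizeUncurryFin
    (AlternatingMap.alternatizeUncurryFinLM ∘ₗ
      ((LieModule.toEnd ℝ 𝔤 𝔤 : 𝔤 →ₗ[ℝ] 𝔤 →ₗ[ℝ] 𝔤).compr₂ f.curryLeft))

lemma ceAux_apply {m : ℕ} (f : 𝔤 [⋀^Fin (m + 1)]→ₗ[ℝ] N) (X : Fin (m + 2) → 𝔤) :
    ceAux f X = ∑ i : Fin (m + 1), ∑ j ≥ i, (-1 : ℤ) ^ (i + (j + 1) : ℕ) •
      f (Matrix.vecCons ⁅X i.castSucc, X j.succ⁆ (j.removeNth (i.castSucc.removeNth X))) := by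
  rw [ceAux, AlternatingMap.smul_apply,
    AlternatingMap.alternatizeUncurryFin_alternatizeUncurryFinLM_comp_apply, Finset.smul_sum]
  refine Finset.sum_congr rfl fun i _ ↦ ?_
  rw [Finset.smul_sum]
  refine Finset.sum_congr rfl fun j _ ↦ ?_
  have h : ⁅X j.succ, X i.castSucc⁆ = -⁅X i.castSucc, X j.succ⁆ := (lie_skew _ _).symm
  simp only [LinearMap.compr₂_apply, LieHom.coe_toLinearMap, LieModule.toEnd_apply_apply, h,
    map_neg, AlternatingMap.neg_apply, AlternatingMap.curryLeft_apply_apply, sub_neg_eq_add]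
  rw [← two_smul ℝ, smul_comm, smul_smul, ← add_assoc, pow_succ]
  norm_num

/-- The Chevalley–Eilenberg differential (trivial coefficients) in positive degree:
`(δf)(X₀,…,X_{m+1}) = ∑_{a<b} (-1)^{a+b} f([X_a,X_b],X₀,…,X̂_a,…,X̂_b,…,X_{m+1})`.
The pair `a < b` is written as `a = i.castSucc`, `b = j.succ` with `i ≤ j`. -/
def ceDiffSucc (m : ℕ) :
    (𝔤 [⋀^Fin (m + 1)]→ₗ[ℝ] N) →ₗ[ℝ] (𝔤 [⋀^Fin (m + 2)]→ₗ[ℝ] N) where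
  toFun f :=
    { toFun X := ∑ i : Fin (m + 1), ∑ j ≥ i, (-1 : ℤ) ^ (i + (j + 1) : ℕ) •
        f (Matrix.vecCons ⁅X i.castSucc, X j.succ⁆ (j.removeNth (i.castSucc.removeNth X)))
      map_update_add' := by
        intro inst v i x y
        obtain rfl : inst = instDecidableEqFin _ := Subsingleton.elim _ _
        simp only [← ceAux_apply, AlternatingMap.map_update_add]
      map_update_smul' := by
        intro inst v i c x
        obtain rfl : inst = instDecidableEqFin _ := Subsingleton.elim _ _
        simp only [← ceAux_apply, AlternatingMap.map_update_smul]
      map_eq_zero_of_eq' := by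
        intro v i j h hij
        simp only [← ceAux_apply]
        exact (ceAux f).map_eq_zero_of_eq v h hij }
  map_add' f g := by
    ext X
    simp [Finset.sum_add_distrib]
  map_smul' c f := by
    ext X
    simp [Finset.smul_sum, smul_comm c]

/-- The Chevalley–Eilenberg differential `δ : Hom(Λᵏ𝔤, N) → Hom(Λᵏ⁺¹𝔤, N)`
(it vanishes on `Λ⁰`). -/
def ceDiff : (k : ℕ) → (𝔤 [⋀^Fin k]→ₗ[ℝ] N) →ₗ[ℝ] (𝔤 [⋀^Fin (k + 1)]→ₗ[ℝ] N)
  | 0 => 0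
  | m + 1 => ceDiffSucc m

variable (𝔤 N) in
/-- Closed `k`-cochains in `Hom(Λᵏ𝔤, N)`. -/
def cocycles (k : ℕ) : Submodule ℝ (𝔤 [⋀^Fin k]→ₗ[ℝ] N) :=
  LinearMap.ker (ceDiff k)

variable (𝔤 N) in
/-- Exact `k`-cochains in `Hom(Λᵏ𝔤, N)`. -/
def coboundaries : (k : ℕ) → Submodule ℝ (𝔤 [⋀^Fin k]→ₗ[ℝ] N)
  | 0 => ⊥
  | m + 1 => LinearMap.range (ceDiff m)

variable (𝔤 N) in
/-- The Lie algebra cohomology `Hᵏ(𝔤; N)` with coefficients in the trivial module `N`;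
`Hᵏ(𝔤)` is the case `N = ℝ`. -/
abbrev LieCohomology (k : ℕ) : Type _ :=
  cocycles 𝔤 N k ⧸ (coboundaries 𝔤 N k).submoduleOf (cocycles 𝔤 N k)

variable (𝔤) in
/-- The operator `δ* : Λᵏ⁺¹𝔤 → Λᵏ𝔤`,
`X₀ ∧ … ∧ X_k ↦ ∑_{a<b} (-1)^{a+b} [X_a,X_b] ∧ X₀ ∧ … ∧ X̂_a ∧ … ∧ X̂_b ∧ … ∧ X_k`. -/
def ceBoundary (k : ℕ) : ⋀[ℝ]^(k + 1) 𝔤 →ₗ[ℝ] ⋀[ℝ]^k 𝔤 :=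
  exteriorPower.alternatingMapLinearEquiv (ceDiff k (exteriorPower.ιMulti ℝ k))

/-- `δ*` is dual to `δ`. -/
lemma ceBoundary_dual (k : ℕ) (f : 𝔤 [⋀^Fin k]→ₗ[ℝ] N) :
    exteriorPower.alternatingMapLinearEquiv (ceDiff k f) =
      exteriorPower.alternatingMapLinearEquiv f ∘ₗ ceBoundary 𝔤 k := by
  refine exteriorPower.linearMap_ext ?_
  ext X
  cases k with
  | zero => simp [ceBoundary, ceDiff]
  | succ m =>
    simp only [LinearMap.compAlternatingMap_apply, LinearMap.comp_apply, ceBoundary,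
      exteriorPower.alternatingMapLinearEquiv_apply_ιMulti]
    simp only [ceDiff, ceDiffSucc, LinearMap.coe_mk, AddHom.coe_mk, AlternatingMap.coe_mk,
      MultilinearMap.coe_mk, map_sum, map_zsmul,
      exteriorPower.alternatingMapLinearEquiv_apply_ιMulti]

variable (𝔤) in
/-- The Lie kernel `P_{𝔤,n} = ker (δ* : Λⁿ𝔤 → Λⁿ⁻¹𝔤)` (all of `Λ⁰𝔤` if `n = 0`). -/
def lieKernel : (n : ℕ) → Submodule ℝ (⋀[ℝ]^n 𝔤)
  | 0 => ⊤
  | k + 1 => LinearMap.ker (ceBoundary 𝔤 k)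

/-- The action of a linear endomorphism `A` on alternating maps by derivations:
`(X₁,…,X_n) ↦ ∑ₗ f(X₁,…,A Xₗ,…,X_n)`. -/
def derivAlt {n : ℕ} (A : 𝔤 →ₗ[ℝ] 𝔤) (f : 𝔤 [⋀^Fin n]→ₗ[ℝ] N) : 𝔤 [⋀^Fin n]→ₗ[ℝ] N where
  toFun X := ∑ l : Fin n, f (Function.update X l (A (X l)))
  map_update_add' := by
    intro inst X i x y
    obtain rfl : inst = instDecidableEqFin _ := Subsingleton.elim _ _
    rw [← Finset.sum_add_distrib]
    refine Finset.sum_congr rfl fun l _ ↦ ?_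
    by_cases h : l = i
    · subst h; simp
    · simp only [Function.update_of_ne h, Function.update_comm (Ne.symm h),
        AlternatingMap.map_update_add]
  map_update_smul' := by
    intro inst X i c x
    obtain rfl : inst = instDecidableEqFin _ := Subsingleton.elim _ _
    rw [Finset.smul_sum]
    refine Finset.sum_congr rfl fun l _ ↦ ?_
    by_cases h : l = i
    · subst h; simp
    · simp only [Function.update_of_ne h, Function.update_comm (Ne.symm h),
        AlternatingMap.map_update_smul]
  map_eq_zero_of_eq' := by
    intro X i j h hij
    rw [Fintype.sum_eq_add i j hij]
    · have : Function.update X j (A (X j)) =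
          Function.update X i (A (X i)) ∘ Equiv.swap i j := by
        ext k
        rcases eq_or_ne k i with rfl | hki
        · simp [hij, h, Function.update_of_ne hij.symm]
        · rcases eq_or_ne k j with rfl | hkj
          · simp [h]
          · simp [Equiv.swap_apply_of_ne_of_ne hki hkj, hki, hkj]
      rw [this, f.map_swap _ hij, add_neg_cancel]
    · rintro l ⟨hli, hlj⟩
      refine f.map_eq_zero_of_eq _ (i := i) (j := j) ?_ hij
      rw [Function.update_of_ne hli.symm, Function.update_of_ne hlj.symm, h]

lemma derivAlt_apply {n : ℕ} (A : 𝔤 →ₗ[ℝ] 𝔤) (f : 𝔤 [⋀^Fin n]→ₗ[ℝ] N) (X : Fin n → 𝔤) :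
    derivAlt A f X = ∑ l : Fin n, f (Function.update X l (A (X l))) := rfl

/-- The adjoint action on `Λⁿ𝔤`:
`ad_X (X₁ ∧ … ∧ X_n) = ∑ₗ X₁ ∧ … ∧ [X,Xₗ] ∧ … ∧ X_n`. -/
def adExt (n : ℕ) (X : 𝔤) : ⋀[ℝ]^n 𝔤 →ₗ[ℝ] ⋀[ℝ]^n 𝔤 :=
  exteriorPower.alternatingMapLinearEquiv
    (derivAlt (LieAlgebra.ad ℝ 𝔤 X) (exteriorPower.ιMulti ℝ n))

lemma ceDiff_derivAlt (k : ℕ) (X : 𝔤) (f : 𝔤 [⋀^Fin k]→ₗ[ℝ] N) :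
    ceDiff k (derivAlt (LieAlgebra.ad ℝ 𝔤 X) f) =
      derivAlt (LieAlgebra.ad ℝ 𝔤 X) (ceDiff k f) := by
  cases k with
  | zero => ext Y; simp [ceDiff, derivAlt_apply]
  | succ m =>
    ext Y
    simp only [derivAlt_apply]
    simp only [ceDiff, ceDiffSucc, LinearMap.coe_mk, AddHom.coe_mk, AlternatingMap.coe_mk,
      MultilinearMap.coe_mk, derivAlt_apply]
    rw [Finset.sum_comm]
    refine Finset.sum_congr rfl fun i _ ↦ ?_
    rw [Finset.sum_comm]
    refine Finset.sum_congr rfl fun j hj ↦ ?_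
    rw [← Finset.smul_sum]
    congr 1
    have hj' : i ≤ j := by simpa using hj
    have hij : i.castSucc.succAbove j = j.succ := by
      simp [Fin.succAbove_of_le_castSucc, hj']
    rw [Fin.sum_univ_succ, Fin.sum_univ_succAbove _ i.castSucc, Fin.sum_univ_succAbove _ j, hij]
    have hne : j.succ ≠ i.castSucc := by
      rw [← hij]; exact Fin.succAbove_ne _ _
    rw [← add_assoc]
    congr 1
    · simp only [Function.update_self, Function.update_of_ne hne, Function.update_of_ne hne.symm,
        Fin.removeNth_update]
      rw [← hij, Fin.removeNth_update_succAbove, Fin.removeNth_update]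
      have hv (x y : 𝔤) (w : Fin m → 𝔤) :
          Function.update (Matrix.vecCons x w : Fin (m + 1) → 𝔤) 0 y = Matrix.vecCons y w := by
        ext t; refine Fin.cases ?_ (fun t ↦ ?_) t <;> simp
      rw [hv]
      simp only [← AlternatingMap.curryLeft_apply_apply, ← AlternatingMap.add_apply, ← map_add]
      rw [Matrix.cons_val_zero, LieAlgebra.ad_apply, leibniz_lie, LieAlgebra.ad_apply,
        LieAlgebra.ad_apply]
    · refine Finset.sum_congr rfl fun u _ ↦ ?_
      congr 1
      have h₁ : i.castSucc ≠ i.castSucc.succAbove (j.succAbove u) := (Fin.succAbove_ne _ _).symm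
      have h₂ : j.succ ≠ i.castSucc.succAbove (j.succAbove u) := by
        rw [← hij]
        exact fun h ↦ Fin.succAbove_ne _ _ (Fin.succAbove_right_injective h).symm
      rw [Function.update_of_ne h₁, Function.update_of_ne h₂, Fin.removeNth_update_succAbove,
        Fin.removeNth_update_succAbove]
      ext t
      refine Fin.cases ?_ (fun t ↦ ?_) t
      · simp [Function.update_of_ne (Fin.succ_ne_zero u).symm]
      · rcases eq_or_ne t u with rfl | htu
        · simp [Fin.removeNth]
        · simp [htu]

/-- `ad_X` preserves the Lie kernel. -/
lemma adExt_mem_lieKernel {n : ℕ} (X : 𝔤) {p : ⋀[ℝ]^n 𝔤} (hp : p ∈ lieKernel 𝔤 n) :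
    adExt n X p ∈ lieKernel 𝔤 n := by
  cases n with
  | zero => trivial
  | succ k =>
    have h : ceBoundary 𝔤 k ∘ₗ adExt (k + 1) X = adExt k X ∘ₗ ceBoundary 𝔤 k := by
      apply exteriorPower.alternatingMapLinearEquiv.symm.injective
      have h₁ : exteriorPower.alternatingMapLinearEquiv.symm
          (ceBoundary 𝔤 k ∘ₗ adExt (k + 1) X) =
          derivAlt (LieAlgebra.ad ℝ 𝔤 X) (ceDiff k (exteriorPower.ιMulti ℝ k)) := by
        ext Y
        simp [adExt, ceBoundary, derivAlt_apply, -exteriorPower.ιMulti_apply_coe]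
      rw [h₁, ← ceDiff_derivAlt, LinearEquiv.eq_symm_apply, adExt, ← ceBoundary_dual]
    have hp' : ceBoundary 𝔤 k p = 0 := hp
    have := LinearMap.congr_fun h p
    simp only [LinearMap.comp_apply, hp', map_zero] at this
    exact this

end LieAlgebraCohomology

/-! ## Differential forms on manifolds -/

section Manifold

variable {E : Type*} [NormedAddCommGroup E] [NormedSpace ℝ E]
variable {M : Type*} [TopologicalSpace M] [ChartedSpace E M]

variable (E M) in
/-- A (not necessarily smooth) differential `k`-form on `M`: an alternating `k`-form on each
tangent space. -/
abbrev RawForm (k : ℕ) : Type _ :=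
  (x : M) → TangentSpace 𝓘(ℝ, E) x [⋀^Fin k]→L[ℝ] ℝ

/-- The representation of a form in the preferred chart at `x₀`, i.e. its pullback along the inverse
of this chart. It is meaningful on the target of the chart. -/
def RawForm.inChart {k : ℕ} (Ω : RawForm E M k) (x₀ : M) (y : E) : E [⋀^Fin k]→L[ℝ] ℝ :=
  (Ω ((extChartAt 𝓘(ℝ, E) x₀).symm y)).compContinuousLinearMap
    (mfderiv 𝓘(ℝ, E) 𝓘(ℝ, E) (extChartAt 𝓘(ℝ, E) x₀).symm y)

/-- A form is smooth if all its chart representations are smooth. -/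
def RawForm.IsSmooth {k : ℕ} (Ω : RawForm E M k) : Prop :=
  ∀ x₀ : M, ContDiffOn ℝ ∞ (Ω.inChart x₀) (extChartAt 𝓘(ℝ, E) x₀).target

/-- The exterior derivative of a differential form: at the point `x₀`, it is the pullback along the
preferred chart at `x₀` of the exterior derivative of the representation in this chart. -/
def RawForm.d {k : ℕ} (Ω : RawForm E M k) : RawForm E M (k + 1) := fun x₀ ↦
  (extDeriv (Ω.inChart x₀) (extChartAt 𝓘(ℝ, E) x₀ x₀)).compContinuousLinearMap
    (mfderiv 𝓘(ℝ, E) 𝓘(ℝ, E) (extChartAt 𝓘(ℝ, E) x₀) x₀)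

/-- The contraction `ι_V Ω` of a form with a vector field (insertion into the first slot). -/
def RawForm.contract {k : ℕ} (V : (x : M) → TangentSpace 𝓘(ℝ, E) x) (Ω : RawForm E M (k + 1)) :
    RawForm E M k := fun x ↦ ContinuousAlternatingMap.curryLeft (E := E) (Ω x) (V x)

/-- The Lie derivative `𝓛_V Ω = d ι_V Ω + ι_V dΩ` of a form of positive degree. -/
def RawForm.lieDeriv {k : ℕ} (V : (x : M) → TangentSpace 𝓘(ℝ, E) x) (Ω : RawForm E M (k + 1)) :
    RawForm E M (k + 1) :=
  (Ω.contract V).d + Ω.d.contract V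

variable (E M) in
/-- `(M, Ω)` is `n`-plectic: `Ω` is a smooth closed `(n+1)`-form such that
`v ↦ ι_v Ω_x` is injective on each tangent space. -/
structure IsNPlectic (n : ℕ) (Ω : RawForm E M (n + 1)) : Prop where
  smooth : Ω.IsSmooth
  closed : Ω.d = 0
  nondegenerate : ∀ x : M,
    Function.Injective (fun v : TangentSpace 𝓘(ℝ, E) x ↦
      ContinuousAlternatingMap.curryLeft (E := E) (Ω x) v)

variable (E M) in
/-- The space `𝔛(M)` of smooth vector fields on `M`. -/
abbrev SmoothVectorField [IsManifold 𝓘(ℝ, E) ∞ M] : Type _ :=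
  ContMDiffSection 𝓘(ℝ, E) E ∞ (TangentSpace 𝓘(ℝ, E) : M → Type _)

variable {𝔤 : Type*} [LieRing 𝔤] [LieAlgebra ℝ 𝔤]

/-- `ζ : 𝔤 → 𝔛(M)` is an infinitesimal `n`-plectic action on `(M, Ω)`: a homomorphism of Lie
algebras with `𝓛_{ζ(X)} Ω = 0` for all `X`. -/
structure IsNPlecticAction [IsManifold 𝓘(ℝ, E) ∞ M] {n : ℕ} (Ω : RawForm E M (n + 1))
    (ζ : 𝔤 →ₗ[ℝ] SmoothVectorField E M) : Prop where
  map_lie : ∀ (X Y : 𝔤) (x : M), ζ ⁅X, Y⁆ x = VectorField.mlieBracket 𝓘(ℝ, E) (ζ X) (ζ Y) x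
  preserves : ∀ X : 𝔤, Ω.lieDeriv (ζ X) = 0

/-- For `v₁,…,v_n` in the tangent space at `x`, the iterated contraction
`ι_{v_n} ⋯ ι_{v_1} Ω_x = Ω_x(v₁,…,v_n,·)`, as an alternating function of `v₁,…,v_n` with
values in the cotangent space. -/
def RawForm.contractMulti {n : ℕ} (Ω : RawForm E M (n + 1)) (x : M) :
    TangentSpace 𝓘(ℝ, E) x [⋀^Fin n]→ₗ[ℝ] Module.Dual ℝ (TangentSpace 𝓘(ℝ, E) x) where
  toFun v :=
    { toFun w := Ω x (Fin.snoc (α := fun _ ↦ TangentSpace 𝓘(ℝ, E) x) v w)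
      map_add' w w' := by
        have h (u) := (Fin.update_snoc_last (α := fun _ ↦ TangentSpace 𝓘(ℝ, E) x) 0 v u).symm
        rw [h (w + w'), h w, h w', ContinuousAlternatingMap.map_update_add]
      map_smul' c w := by
        have h (u) := (Fin.update_snoc_last (α := fun _ ↦ TangentSpace 𝓘(ℝ, E) x) 0 v u).symm
        rw [h (c • w), h w, ContinuousAlternatingMap.map_update_smul, RingHom.id_apply] }
  map_update_add' := by
    intro inst v i a b
    obtain rfl : inst = instDecidableEqFin _ := Subsingleton.elim _ _
    ext w
    simp [Fin.snoc_update]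
  map_update_smul' := by
    intro inst v i c a
    obtain rfl : inst = instDecidableEqFin _ := Subsingleton.elim _ _
    ext w
    simp [Fin.snoc_update]
  map_eq_zero_of_eq' := by
    intro v i j h hij
    ext w
    refine (Ω x).map_eq_zero_of_eq _ (i := i.castSucc) (j := j.castSucc) ?_ (by simpa using hij)
    simpa using h

/-- Evaluation `𝔤 → T_x M`, `X ↦ ζ(X)(x)`. -/
def evalAt [IsManifold 𝓘(ℝ, E) ∞ M] (ζ : 𝔤 →ₗ[ℝ] SmoothVectorField E M) (x : M) :
    𝔤 →ₗ[ℝ] TangentSpace 𝓘(ℝ, E) x where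
  toFun X := ζ X x
  map_add' X Y := by rw [map_add]; rfl
  map_smul' c X := by rw [map_smul]; rfl

/-- The covector `(ι_{ζ(p)} Ω)_x`, for `p ∈ Λⁿ𝔤`: the linear extension of
`X₁ ∧ … ∧ X_n ↦ ι_{ζ(X_n)} ⋯ ι_{ζ(X₁)} Ω`. -/
def contractExt [IsManifold 𝓘(ℝ, E) ∞ M] {n : ℕ} (Ω : RawForm E M (n + 1))
    (ζ : 𝔤 →ₗ[ℝ] SmoothVectorField E M) (x : M) :
    ⋀[ℝ]^n 𝔤 →ₗ[ℝ] Module.Dual ℝ (TangentSpace 𝓘(ℝ, E) x) :=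
  exteriorPower.alternatingMapLinearEquiv ((Ω.contractMulti x).compLinearMap (evalAt ζ x))

/-- `v : M → P_𝔤*` is a multi-moment map for the action `ζ` on `(M, Ω)`. Write `v̄(p)` for the
function `x ↦ v(x)(p)`. The conditions are: `v` is smooth (i.e. all `v̄(p)` are smooth, `P_𝔤`
being finite-dimensional), `d(v̄(p)) = ι_{ζ(p)} Ω` for `p ∈ P_𝔤`, and
`v̄(ad_X p) = 𝓛_{ζ(X)} (v̄(p))` for `X ∈ 𝔤` and `p ∈ P_𝔤`. -/
structure IsMultiMomentMap [IsManifold 𝓘(ℝ, E) ∞ M] {n : ℕ} (Ω : RawForm E M (n + 1))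
    (ζ : 𝔤 →ₗ[ℝ] SmoothVectorField E M) (v : M → Module.Dual ℝ (lieKernel 𝔤 n)) : Prop where
  smooth : ∀ p : lieKernel 𝔤 n, ContMDiff 𝓘(ℝ, E) 𝓘(ℝ, ℝ) ∞ (fun x ↦ v x p)
  deriv_eq : ∀ (p : lieKernel 𝔤 n) (x : M) (w : TangentSpace 𝓘(ℝ, E) x),
    mvfderiv 𝓘(ℝ, E) (fun y ↦ v y p) x w = contractExt Ω ζ x p w
  equivariant : ∀ (X : 𝔤) (p : lieKernel 𝔤 n) (x : M),
    v x ⟨adExt n X p, adExt_mem_lieKernel X p.2⟩ =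
      mvfderiv 𝓘(ℝ, E) (fun y ↦ v y p) x (ζ X x)

end Manifold

end

end MultiMoment

/-! At each point x the action gives an (n+1)-cochain φ_x(Y₀,…,Yₙ) = Ω(ζY₀,…,ζYₙ), which is a
cocycle. If Hⁿ⁺¹(𝔤) = 0 then φ_x = δb_x, and b_x is determined up to n-cocycles. If Hⁿ(𝔤) = 0 these
are coboundaries, hence vanish on P_𝔤 = ker δ*. So b_x restricted to P_𝔤 is canonical, and up to
sign it is the value of the moment map. To obtain smoothness in x, `exists_isMultiMomentMap` takes
b_x = Bφ_x for one linear quasi-inverse B of δ.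

Both conditions follow from derivatives of φ. In a direction w the derivative is −δ of the pullback
of ι_wΩ (`IsInvariantJet.deriv_apply`), and B recovers that pullback on P_𝔤. Along ζ(X) it is the
derivation induced by ad_X (`IsInvariantJet.deriv_along`), which commutes with δ.

These formulas are pointwise linear algebra. They use only the values and first derivatives of Ω and
ζ in the preferred chart, subject to three identities: closedness, invariance and the bracket
formula. `IsInvariantJet` records these, and `IsNPlecticAction.isInvariantJet` derives them from the
geometry. -/

namespace MultiMoment

/-! ### Pointwise Cartan calculus on first-order jets. -/

section LinearAlgebra

variable {𝔤 : Type*} [LieRing 𝔤] [LieAlgebra ℝ 𝔤]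
variable {E : Type*} [AddCommGroup E] [Module ℝ E]

/-- If `V : 𝔤 → E` and `A : 𝔤 → End E` satisfy `V [X, Y] = A_Y (V X) - A_X (V Y)`, then the
alternating sum of the derivations `A_{Y_i}` applied to `η` computes the Chevalley–Eilenberg
differential of the pullback of `η` along `V`. -/
theorem sum_sum_update_eq_ceDiffSucc {m : ℕ} (V : 𝔤 →ₗ[ℝ] E) (A : 𝔤 →ₗ[ℝ] E →ₗ[ℝ] E)
    (hV : ∀ X Y, V ⁅X, Y⁆ = A Y (V X) - A X (V Y)) (η : E [⋀^Fin (m + 1)]→ₗ[ℝ] ℝ)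
    (Y : Fin (m + 2) → 𝔤) :
    ∑ i : Fin (m + 2), (-1) ^ (i : ℕ) • ∑ l : Fin (m + 1),
      η (Function.update (i.removeNth fun k ↦ V (Y k)) l (A (Y i) (i.removeNth (fun k ↦ V (Y k)) l)))
      = ceDiffSucc m (η.compLinearMap V) Y := by
  let compLM : (E [⋀^Fin m]→ₗ[ℝ] ℝ) →ₗ[ℝ] (𝔤 [⋀^Fin m]→ₗ[ℝ] ℝ) :=
    { toFun f := f.compLinearMap V
      map_add' _ _ := rfl
      map_smul' _ _ := rfl }
  -- The sum over i and l is the twofold alternatization of b. Grouping the two orders of each pair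
  -- antisymmetrizes b in its first two arguments, and `hV` turns the result into a bracket.
  let b : 𝔤 →ₗ[ℝ] 𝔤 →ₗ[ℝ] 𝔤 [⋀^Fin m]→ₗ[ℝ] ℝ :=
    (A.compr₂ (compLM ∘ₗ η.curryLeft)).compl₂ V
  have hb (X Z : 𝔤) (R : Fin m → 𝔤) :
      b X Z R = η (Matrix.vecCons (A X (V Z)) fun k ↦ V (R k)) := rfl
  have h := AlternatingMap.alternatizeUncurryFin_alternatizeUncurryFinLM_comp_apply b Y
  have hl : AlternatingMap.alternatizeUncurryFin (AlternatingMap.alternatizeUncurryFinLM ∘ₗ b) Y =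
      ∑ i : Fin (m + 2), (-1) ^ (i : ℕ) • ∑ l : Fin (m + 1), η (Function.update
        (i.removeNth fun k ↦ V (Y k)) l (A (Y i) (i.removeNth (fun k ↦ V (Y k)) l))) := by
    rw [AlternatingMap.alternatizeUncurryFin_apply]
    refine Finset.sum_congr rfl fun i _ ↦ ?_
    congr 1
    rw [LinearMap.comp_apply, AlternatingMap.alternatizeUncurryFinLM_apply,
      AlternatingMap.alternatizeUncurryFin_apply]
    refine Finset.sum_congr rfl fun l _ ↦ ?_
    rw [hb, ← Fin.insertNth_removeNth, AlternatingMap.map_insertNth]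
    rfl
  rw [← hl, h]
  change _ = ∑ i : Fin (m + 1), ∑ j ≥ i, _
  refine Finset.sum_congr rfl fun i _ ↦ Finset.sum_congr rfl fun j _ ↦ ?_
  -- The shift j + 1 in the exponent of δ contributes a sign, absorbed by reversing the difference
  -- in `hV`.
  rw [← add_assoc, pow_succ, mul_neg_one, neg_smul, ← smul_neg]
  congr 1
  have hc (R : Fin m → 𝔤) (X : 𝔤) : η.compLinearMap V (Matrix.vecCons X R) =
      η.curryLeft (V X) fun k ↦ V (R k) := by
    rw [AlternatingMap.compLinearMap_apply, AlternatingMap.curryLeft_apply_apply]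
    congr 1
    ext k
    refine Fin.cases ?_ (fun k ↦ ?_) k <;> simp
  rw [hc, hV, hb, hb, map_sub, AlternatingMap.sub_apply, neg_sub]
  rfl

/-- Closedness on (v, u₀, …, uₙ), with the term differentiated along v isolated. It trades the
direction of differentiation for an argument of the form. -/
theorem eq_sum_vecCons_of_closed {n : ℕ} {D : E → E [⋀^Fin (n + 1)]→ₗ[ℝ] ℝ}
    (hD : ∀ u : Fin (n + 2) → E, ∑ i : Fin (n + 2), (-1) ^ (i : ℕ) • D (u i) (i.removeNth u) = 0)
    (v : E) (u : Fin (n + 1) → E) :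
    D v u = ∑ i : Fin (n + 1), (-1) ^ (i : ℕ) • D (u i) (Matrix.vecCons v (i.removeNth u)) := by
  have hc := hD (Matrix.vecCons v u)
  rw [Fin.sum_univ_succ] at hc
  have h0 : (0 : Fin (n + 2)).removeNth (Matrix.vecCons v u) = u := by
    ext k; simp [Fin.removeNth]
  rw [h0] at hc
  simp only [Fin.val_zero, pow_zero, one_smul, Matrix.cons_val_zero] at hc
  rw [eq_neg_of_add_eq_zero_left hc, ← Finset.sum_neg_distrib]
  refine Finset.sum_congr rfl fun i _ ↦ ?_
  have h1 : i.succ.removeNth (Matrix.vecCons v u) = Matrix.vecCons v (i.removeNth u) := by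
    ext k
    refine Fin.cases ?_ (fun k ↦ ?_) k <;> simp [Fin.removeNth]
  rw [h1, Matrix.cons_val_succ, Fin.val_succ, pow_succ, mul_neg_one, neg_smul, neg_neg]

/-- Cartan's formula at a point: `d ι_v η = 0` and `d η = 0` give the invariance of `η`. -/
theorem invariant_of_closed_contract {n : ℕ} {η : E [⋀^Fin (n + 1)]→ₗ[ℝ] ℝ}
    {D : E → E [⋀^Fin (n + 1)]→ₗ[ℝ] ℝ}
    (hD : ∀ u : Fin (n + 2) → E, ∑ i : Fin (n + 2), (-1) ^ (i : ℕ) • D (u i) (i.removeNth u) = 0)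
    (v : E) (a : E → E) (u : Fin (n + 1) → E)
    (h : ∑ i : Fin (n + 1), (-1) ^ (i : ℕ) • (D (u i) (Matrix.vecCons v (i.removeNth u)) +
      η (Matrix.vecCons (a (u i)) (i.removeNth u))) = 0) :
    D v u + ∑ l, η (Function.update u l (a (u l))) = 0 := by
  rw [eq_sum_vecCons_of_closed hD, ← Finset.sum_add_distrib, ← h]
  refine Finset.sum_congr rfl fun i _ ↦ ?_
  rw [← Fin.insertNth_removeNth i, AlternatingMap.map_insertNth, smul_add]

/-- `D` is the derivative of a closed form and `η` its value at a point; `V` and `A` are the values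
and derivatives of the vector fields of an action preserving the form. -/
structure IsInvariantJet {n : ℕ} (η : E [⋀^Fin (n + 1)]→ₗ[ℝ] ℝ)
    (D : E → E [⋀^Fin (n + 1)]→ₗ[ℝ] ℝ) (V : 𝔤 →ₗ[ℝ] E) (A : 𝔤 →ₗ[ℝ] E →ₗ[ℝ] E) : Prop where
  closed : ∀ u : Fin (n + 2) → E, ∑ i : Fin (n + 2), (-1) ^ (i : ℕ) • D (u i) (i.removeNth u) = 0
  invariant : ∀ (X : 𝔤) (u : Fin (n + 1) → E),
    D (V X) u + ∑ l, η (Function.update u l (A X (u l))) = 0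
  map_lie : ∀ X Y, V ⁅X, Y⁆ = A Y (V X) - A X (V Y)

namespace IsInvariantJet

variable {n : ℕ} {η : E [⋀^Fin (n + 1)]→ₗ[ℝ] ℝ} {D : E → E [⋀^Fin (n + 1)]→ₗ[ℝ] ℝ}
  {V : 𝔤 →ₗ[ℝ] E} {A : 𝔤 →ₗ[ℝ] E →ₗ[ℝ] E}

/-- In the closedness identity on the vectors V Yᵢ, invariance replaces every derivative D(V Yᵢ) by
minus a sum of A-terms. By the bracket formula their alternating sum is −δ of the pullback. -/
theorem ceDiff_eq_zero (h : IsInvariantJet η D V A) : ceDiff (n + 1) (η.compLinearMap V) = 0 := by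
  ext Y
  change ceDiffSucc n _ Y = 0
  rw [← sum_sum_update_eq_ceDiffSucc V A h.map_lie, ← neg_eq_zero, ← Finset.sum_neg_distrib,
    ← h.closed fun k ↦ V (Y k)]
  refine Finset.sum_congr rfl fun i _ ↦ ?_
  rw [eq_neg_of_add_eq_zero_left (h.invariant (Y i) _), smul_neg]

/-- The derivative of `η(V Y₀, …, V Yₙ)` along a vector field of the action. -/
theorem deriv_along (h : IsInvariantJet η D V A) (X : 𝔤) (Y : Fin (n + 1) → 𝔤) :
    D (V X) (fun k ↦ V (Y k)) +
      ∑ l, η (Function.update (fun k ↦ V (Y k)) l (A (Y l) (V X))) =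
      derivAlt (LieAlgebra.ad ℝ 𝔤 X) (η.compLinearMap V) Y := by
  rw [eq_neg_of_add_eq_zero_left (h.invariant X _), neg_add_eq_sub, ← Finset.sum_sub_distrib,
    derivAlt_apply]
  refine Finset.sum_congr rfl fun l _ ↦ ?_
  -- Slot l now holds A_{Y_l}(V X) − A_X(V Y_l) = V[X, Y_l].
  rw [← AlternatingMap.map_update_sub, ← h.map_lie, AlternatingMap.compLinearMap_apply]
  congr 1
  ext k
  rcases eq_or_ne k l with rfl | hk
  · simp
  · simp [hk]

/-- The derivative of `η(V Y₀, …, V Yₙ)` in an arbitrary direction. -/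
theorem deriv_apply {m : ℕ} {η : E [⋀^Fin (m + 2)]→ₗ[ℝ] ℝ}
    {D : E → E [⋀^Fin (m + 2)]→ₗ[ℝ] ℝ} (h : IsInvariantJet η D V A) (w : E)
    (Y : Fin (m + 2) → 𝔤) :
    D w (fun k ↦ V (Y k)) +
      ∑ l, η (Function.update (fun k ↦ V (Y k)) l (A (Y l) w)) =
      -ceDiff (m + 1) ((η.curryLeft w).compLinearMap V) Y := by
  change _ = -ceDiffSucc m _ Y
  rw [← sum_sum_update_eq_ceDiffSucc V A h.map_lie]
  rw [eq_sum_vecCons_of_closed h.closed, ← Finset.sum_add_distrib, ← Finset.sum_neg_distrib]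
  refine Finset.sum_congr rfl fun i _ ↦ ?_
  -- Invariance along V Yᵢ is applied with w in slot 0. The slot-0 terms η(A_{Yᵢ} w, …) cancel the
  -- second sum of the left side. The other slots leave w untouched and assemble to δ of the
  -- pulled-back ι_w η.
  rw [eq_neg_of_add_eq_zero_left (h.invariant (Y i) _), Fin.sum_univ_succ]
  have h2 (z : E) (R : Fin (m + 1) → E) :
      Function.update (Matrix.vecCons w R) 0 z = Matrix.vecCons z R := by
    ext k
    refine Fin.cases ?_ (fun k ↦ ?_) k <;> simp
  have h3 (z : E) (l : Fin (m + 1)) (R : Fin (m + 1) → E) :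
      Function.update (Matrix.vecCons w R) l.succ z = Matrix.vecCons w (Function.update R l z) := by
    ext k
    refine Fin.cases (by simp [Function.update_of_ne (Fin.succ_ne_zero l).symm]) (fun k ↦ ?_) k
    rcases eq_or_ne k l with rfl | hk
    · simp
    · simp [hk]
  simp only [h2, h3, Matrix.cons_val_zero, Matrix.cons_val_succ,
    AlternatingMap.curryLeft_apply_apply]
  rw [← Fin.insertNth_removeNth i, AlternatingMap.map_insertNth]
  simp only [smul_add, smul_neg, neg_add]
  abel

end IsInvariantJet

/-- The differential calculus inserts w first, the multi-moment condition inserts it last; w passes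
n arguments. -/
theorem curryLeft_eq_map_snoc {n : ℕ} (η : E [⋀^Fin (n + 1)]→ₗ[ℝ] ℝ) (v : Fin n → E) (w : E) :
    η.curryLeft w v = (-1 : ℝ) ^ n * η (Fin.snoc (α := fun _ ↦ E) v w) := by
  rw [← Fin.insertNth_last', AlternatingMap.map_insertNth, Fin.val_last, zsmul_eq_mul,
    AlternatingMap.curryLeft_apply_apply]
  push_cast
  rw [← mul_assoc, ← mul_pow, neg_mul_neg, one_mul, one_pow, one_mul]

end LinearAlgebra

/-! ### Consequences of vanishing cohomology, and duality with the Lie kernel. -/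

section Cohomology

variable {𝔤 : Type*} [LieRing 𝔤] [LieAlgebra ℝ 𝔤]

/-- All 0-cochains are closed and only 0 is exact, so H⁰(𝔤) = ℝ. This excludes n = 0. -/
theorem not_subsingleton_lieCohomology_zero : ¬ Subsingleton (LieCohomology 𝔤 ℝ 0) := by
  intro h
  replace h := Submodule.Quotient.subsingleton_iff.mp h
  let f : cocycles 𝔤 ℝ 0 := ⟨AlternatingMap.constOfIsEmpty ℝ 𝔤 (Fin 0) 1, by
    simp [cocycles, ceDiff]⟩
  have hf : f ∈ (coboundaries 𝔤 ℝ 0).submoduleOf (cocycles 𝔤 ℝ 0) := h ▸ Submodule.mem_top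
  have hf' : (AlternatingMap.constOfIsEmpty ℝ 𝔤 (Fin 0) (1 : ℝ)) = 0 := hf
  simpa using DFunLike.congr_fun hf' ![]

theorem exists_ceDiff_eq {m : ℕ} (h : Subsingleton (LieCohomology 𝔤 ℝ (m + 1)))
    {f : 𝔤 [⋀^Fin (m + 1)]→ₗ[ℝ] ℝ} (hf : ceDiff (m + 1) f = 0) : ∃ g, ceDiff m g = f := by
  replace h := Submodule.Quotient.subsingleton_iff.mp h
  have : (⟨f, hf⟩ : cocycles 𝔤 ℝ (m + 1)) ∈
      (coboundaries 𝔤 ℝ (m + 1)).submoduleOf (cocycles 𝔤 ℝ (m + 1)) := h ▸ Submodule.mem_top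
  exact this

/-- If `Hⁿ(𝔤) = 0`, closed cochains of degree `n` vanish on the Lie kernel. -/
theorem alternatingMapLinearEquiv_eq_zero_of_mem_lieKernel {m : ℕ}
    (h : Subsingleton (LieCohomology 𝔤 ℝ (m + 1)))
    {f : 𝔤 [⋀^Fin (m + 1)]→ₗ[ℝ] ℝ} (hf : ceDiff (m + 1) f = 0) {p : ⋀[ℝ]^(m + 1) 𝔤}
    (hp : p ∈ lieKernel 𝔤 (m + 1)) : exteriorPower.alternatingMapLinearEquiv f p = 0 := by
  obtain ⟨g, rfl⟩ := exists_ceDiff_eq h hf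
  have hp' : ceBoundary 𝔤 m p = 0 := hp
  rw [ceBoundary_dual, LinearMap.comp_apply, hp', map_zero]

theorem alternatingMapLinearEquiv_adExt {n : ℕ} (f : 𝔤 [⋀^Fin n]→ₗ[ℝ] ℝ) (X : 𝔤)
    (p : ⋀[ℝ]^n 𝔤) :
    exteriorPower.alternatingMapLinearEquiv f (adExt n X p) =
      exteriorPower.alternatingMapLinearEquiv (derivAlt (LieAlgebra.ad ℝ 𝔤 X) f) p := by
  rw [← LinearMap.comp_apply]
  congr 1
  refine exteriorPower.linearMap_ext ?_
  ext Y
  simp [adExt, derivAlt_apply, -exteriorPower.ιMulti_apply_coe]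

/-- A linear map between vector spaces has a linear quasi-inverse. -/
theorem exists_linearMap_quasiInverse {U W : Type*} [AddCommGroup U] [Module ℝ U]
    [AddCommGroup W] [Module ℝ W] (f : U →ₗ[ℝ] W) : ∃ g : W →ₗ[ℝ] U, ∀ u, f (g (f u)) = f u := by
  obtain ⟨s, hs⟩ := f.rangeRestrict.exists_rightInverse_of_surjective f.range_rangeRestrict
  obtain ⟨g, hg⟩ := s.exists_extend
  refine ⟨g, fun u ↦ ?_⟩
  have h1 : g (f u) = s (f.rangeRestrict u) := LinearMap.congr_fun hg (f.rangeRestrict u)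
  rw [h1]
  exact congrArg Subtype.val (LinearMap.congr_fun hs (f.rangeRestrict u))

/-- A linear functional on alternating forms on a finite-dimensional space is a linear combination
of evaluations. -/
theorem exists_eq_sum_eval [Module.Finite ℝ 𝔤] {k : ℕ} (ℓ : (𝔤 [⋀^Fin k]→ₗ[ℝ] ℝ) →ₗ[ℝ] ℝ) :
    ∃ (ι : Type) (_ : Fintype ι) (a : ι → ℝ) (e : ι → Fin k → 𝔤), ∀ f, ℓ f = ∑ i, a i * f (e i) := by
  let b := Module.finBasis ℝ 𝔤
  let ev : (𝔤 [⋀^Fin k]→ₗ[ℝ] ℝ) →ₗ[ℝ] ((Fin k → Fin (Module.finrank ℝ 𝔤)) → ℝ) :=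
    { toFun f I := f fun j ↦ b (I j)
      map_add' _ _ := rfl
      map_smul' _ _ := rfl }
  have hev : LinearMap.ker ev = ⊥ := by
    rw [LinearMap.ker_eq_bot]
    intro f g hfg
    exact b.ext_alternating fun I _ ↦ congrFun hfg I
  -- All basis tuples occur, so the evaluations are redundant and `ev` is only injective. A left
  -- inverse s gives ℓ = (ℓ ∘ s) ∘ ev, whose coefficients are the values of ℓ ∘ s on the standard
  -- basis.
  obtain ⟨s, hs⟩ := ev.exists_leftInverse_of_injective hev
  refine ⟨_, inferInstance, fun I ↦ ℓ (s (Pi.single I 1)), fun I j ↦ b (I j), fun f ↦ ?_⟩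
  have h1 : s (ev f) = f := LinearMap.congr_fun hs f
  conv_lhs => rw [← h1, pi_eq_sum_univ' (ev f)]
  simp only [map_sum, map_smul, smul_eq_mul]
  exact Finset.sum_congr rfl fun I _ ↦ mul_comm _ _

end Cohomology

noncomputable section

/-! ### Forms and vector fields in the preferred chart. -/

section Chart

open Set Topology

variable {E : Type*} [NormedAddCommGroup E] [NormedSpace ℝ E]

theorem contDiffAt_alternating_apply {k : ℕ} {η : E → E [⋀^Fin k]→L[ℝ] ℝ} {V : Fin k → E → E}
    {y : E} (hη : ContDiffAt ℝ ∞ η y) (hV : ∀ i, ContDiffAt ℝ ∞ (V i) y) :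
    ContDiffAt ℝ ∞ (fun z ↦ η z fun i ↦ V i z) y := by
  -- Evaluation is seen as v ↦ (η ↦ η v), continuous multilinear in v with values in linear
  -- functionals on forms.
  let ev := (ContinuousLinearMap.id ℝ (E [⋀^Fin k]→L[ℝ] ℝ)).flipAlternating
  have h : ContDiff ℝ ∞ ev := by
    have := ContinuousMultilinearMap.contDiff (𝕜 := ℝ) (n := ∞) (E := fun _ : Fin k ↦ E)
      (F := (E [⋀^Fin k]→L[ℝ] ℝ) →L[ℝ] ℝ) ev.toContinuousMultilinearMap
    exact this
  have h' : ContDiffAt ℝ ∞ (fun z i ↦ V i z) y := contDiffAt_pi.2 hV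
  exact (h.contDiffAt.comp y h').clm_apply hη

theorem hasFDerivAt_curryLeft_apply {k : ℕ} {η : E → E [⋀^Fin (k + 1)]→L[ℝ] ℝ} {V : E → E} {y : E}
    {η' : E →L[ℝ] E [⋀^Fin (k + 1)]→L[ℝ] ℝ} {V' : E →L[ℝ] E}
    (hη : HasFDerivAt η η' y) (hV : HasFDerivAt V V' y) :
    HasFDerivAt (fun z ↦ (η z).curryLeft (V z))
      ((ContinuousAlternatingMap.curryLeftLI.toContinuousLinearMap ∘L η').flip (V y) +
        (η y).curryLeft ∘L V') y := by
  have h := (ContinuousAlternatingMap.curryLeftLI (𝕜 := ℝ) (E := E) (F := ℝ)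
    (n := k)).toContinuousLinearMap.hasFDerivAt_of_bilinear hη hV
  rw [add_comm]
  exact h

variable {M : Type*} [TopologicalSpace M] [ChartedSpace E M]

theorem extChartAt_target_mem_nhds_self (x₀ : M) :
    (extChartAt 𝓘(ℝ, E) x₀).target ∈ 𝓝 (extChartAt 𝓘(ℝ, E) x₀ x₀) :=
  extChartAt_target_mem_nhds x₀

/-- The representation of a vector field in the preferred chart at `x₀`. -/
def chartField (V : (x : M) → TangentSpace 𝓘(ℝ, E) x) (x₀ : M) : E → E :=
  VectorField.mpullbackWithin 𝓘(ℝ, E) 𝓘(ℝ, E) (extChartAt 𝓘(ℝ, E) x₀).symm V (range 𝓘(ℝ, E))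

theorem RawForm.IsSmooth.contDiffAt_inChart {k : ℕ} {Ω : RawForm E M k} (hΩ : Ω.IsSmooth)
    (x₀ : M) : ContDiffAt ℝ ∞ (Ω.inChart x₀) (extChartAt 𝓘(ℝ, E) x₀ x₀) :=
  (hΩ x₀).contDiffAt (extChartAt_target_mem_nhds_self x₀)

variable [IsManifold 𝓘(ℝ, E) ∞ M]

instance : IsManifold 𝓘(ℝ, E) 1 M := IsManifold.of_le (n := ∞) (by simp)

/-- The tangent space at x₀ is a copy of E identified through the preferred chart at x₀, so the
derivative of that chart at x₀ is the identity. Chart representatives therefore keep their values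
there. -/
theorem chartField_self (V : (x : M) → TangentSpace 𝓘(ℝ, E) x) (x₀ : M) :
    chartField V x₀ (extChartAt 𝓘(ℝ, E) x₀ x₀) = V x₀ := by
  have h := mfderivWithin_extChartAt_symm_inverse_apply (I := 𝓘(ℝ, E))
    (v := (V ((extChartAt 𝓘(ℝ, E) x₀).symm (extChartAt 𝓘(ℝ, E) x₀ x₀)) : E)) (x := x₀)
  refine h.trans ?_
  have h' (x : M) (hx : x = x₀) : (V x : E) = V x₀ := by rw [hx]
  exact h' _ (extChartAt_to_inv x₀)

theorem mfderiv_extChartAt_symm_self (x₀ : M) (u : E) :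
    mfderiv 𝓘(ℝ, E) 𝓘(ℝ, E) (extChartAt 𝓘(ℝ, E) x₀).symm (extChartAt 𝓘(ℝ, E) x₀ x₀) u = u := by
  have h := mfderivWithin_range_extChartAt_symm (I := 𝓘(ℝ, E)) (x := x₀)
  rw [ModelWithCorners.range_eq_univ, mfderivWithin_univ] at h
  exact DFunLike.congr_fun h u

theorem mfderiv_extChartAt_symm_chartField (V : (x : M) → TangentSpace 𝓘(ℝ, E) x) {x₀ : M} {y : E}
    (hy : y ∈ (extChartAt 𝓘(ℝ, E) x₀).target) :
    mfderiv 𝓘(ℝ, E) 𝓘(ℝ, E) (extChartAt 𝓘(ℝ, E) x₀).symm y (chartField (E := E) V x₀ y) =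
      V ((extChartAt 𝓘(ℝ, E) x₀).symm y) := by
  have h := isInvertible_mfderivWithin_extChartAt_symm (I := 𝓘(ℝ, E)) hy
  have h' := h.self_apply_inverse (V ((extChartAt 𝓘(ℝ, E) x₀).symm y))
  nth_rw 1 [ModelWithCorners.range_eq_univ, mfderivWithin_univ] at h'
  exact h'

theorem inChart_apply_chartField {k : ℕ} (Ω : RawForm E M k) {x₀ : M} {y : E}
    (hy : y ∈ (extChartAt 𝓘(ℝ, E) x₀).target)
    (V : Fin k → (x : M) → TangentSpace 𝓘(ℝ, E) x) :
    Ω.inChart x₀ y (fun i ↦ chartField (V i) x₀ y) =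
      Ω ((extChartAt 𝓘(ℝ, E) x₀).symm y) fun i ↦ V i ((extChartAt 𝓘(ℝ, E) x₀).symm y) :=
  congrArg (Ω ((extChartAt 𝓘(ℝ, E) x₀).symm y))
    (funext fun i ↦ mfderiv_extChartAt_symm_chartField (V i) hy)

theorem inChart_self {k : ℕ} (Ω : RawForm E M k) (x₀ : M) (u : Fin k → E) :
    Ω.inChart x₀ (extChartAt 𝓘(ℝ, E) x₀ x₀) u = Ω x₀ u := by
  have h (x : M) (hx : x = x₀) : Ω x (u : Fin k → E) = Ω x₀ u := by subst hx; rfl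
  refine (congrArg (Ω ((extChartAt 𝓘(ℝ, E) x₀).symm (extChartAt 𝓘(ℝ, E) x₀ x₀)))
    (funext fun i ↦ ?_)).trans (h _ (extChartAt_to_inv x₀))
  exact mfderiv_extChartAt_symm_self x₀ (u i)

theorem extDeriv_inChart_eq_zero {k : ℕ} {Ω : RawForm E M k} {x₀ : M} (h : Ω.d x₀ = 0) :
    extDeriv (Ω.inChart x₀) (extChartAt 𝓘(ℝ, E) x₀ x₀) = 0 := by
  ext u
  have h1 := DFunLike.congr_fun h u
  rw [RawForm.d, mfderiv_extChartAt_self] at h1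
  exact h1

theorem inChart_contract {k : ℕ} (Ω : RawForm E M (k + 1)) {x₀ : M} {y : E}
    (hy : y ∈ (extChartAt 𝓘(ℝ, E) x₀).target) (V : (x : M) → TangentSpace 𝓘(ℝ, E) x) :
    (Ω.contract V).inChart x₀ y = (Ω.inChart x₀ y).curryLeft (chartField V x₀ y) := by
  ext u
  refine congrArg (Ω ((extChartAt 𝓘(ℝ, E) x₀).symm y)) (funext fun i ↦ ?_)
  refine Fin.cases ?_ (fun i ↦ ?_) i
  · exact (mfderiv_extChartAt_symm_chartField V hy).symm
  · rfl

/-- The exterior derivative of `ι_V Ω` in a chart. -/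
theorem extDeriv_inChart_contract_apply {k : ℕ} {Ω : RawForm E M (k + 1)} (hΩ : Ω.IsSmooth)
    {V : (x : M) → TangentSpace 𝓘(ℝ, E) x} {x₀ : M}
    (hV : DifferentiableAt ℝ (chartField V x₀) (extChartAt 𝓘(ℝ, E) x₀ x₀))
    (u : Fin (k + 1) → E) :
    extDeriv ((Ω.contract V).inChart x₀) (extChartAt 𝓘(ℝ, E) x₀ x₀) u =
      ∑ i : Fin (k + 1), (-1) ^ (i : ℕ) •
        (fderiv ℝ (Ω.inChart x₀) (extChartAt 𝓘(ℝ, E) x₀ x₀) (u i)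
          (Matrix.vecCons (V x₀) (i.removeNth u)) +
        Ω x₀ (Matrix.vecCons (fderiv ℝ (chartField V x₀) (extChartAt 𝓘(ℝ, E) x₀ x₀) (u i))
          (i.removeNth u))) := by
  set y := extChartAt 𝓘(ℝ, E) x₀ x₀ with hy
  have hω : DifferentiableAt ℝ (Ω.inChart x₀) y :=
    (hΩ.contDiffAt_inChart x₀).differentiableAt (by simp)
  have he : (Ω.contract V).inChart x₀ =ᶠ[𝓝 y]
      fun z ↦ (Ω.inChart x₀ z).curryLeft (chartField V x₀ z) :=
    Filter.eventually_of_mem (extChartAt_target_mem_nhds_self x₀) fun z hz ↦ inChart_contract Ω hz V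
  have hd := hasFDerivAt_curryLeft_apply hω.hasFDerivAt hV.hasFDerivAt
  rw [extDeriv, he.fderiv_eq, hd.fderiv, ContinuousAlternatingMap.alternatizeUncurryFin_apply]
  refine Finset.sum_congr rfl fun i _ ↦ ?_
  congr 1
  exact congrArg₂ (· + ·)
    (congrArg (fun a : E ↦ fderiv ℝ (Ω.inChart x₀) y (u i) (Matrix.vecCons a (i.removeNth u)))
      (chartField_self V x₀)) (inChart_self Ω x₀ _)

/-- The bracket on M is defined in the preferred chart and pulled back; at x₀ the pullback is the
identity. -/
theorem lieBracket_chartField (V W : (x : M) → TangentSpace 𝓘(ℝ, E) x) (x₀ : M) :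
    VectorField.mlieBracket 𝓘(ℝ, E) V W x₀ =
      VectorField.lieBracket ℝ (chartField V x₀) (chartField W x₀) (extChartAt 𝓘(ℝ, E) x₀ x₀) := by
  have h (u : E) : (mfderiv 𝓘(ℝ, E) 𝓘(ℝ, E) (extChartAt 𝓘(ℝ, E) x₀) x₀).inverse u = u := by
    rw [mfderiv_extChartAt_self]
    exact DFunLike.congr_fun (ContinuousLinearMap.inverse_id (R := ℝ) (M := E)) u
  refine (h _).trans ?_
  change VectorField.lieBracketWithin ℝ (chartField V x₀) (chartField W x₀) _ _ = _
  rw [preimage_univ, univ_inter, ModelWithCorners.range_eq_univ, VectorField.lieBracketWithin_univ]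

theorem contDiffAt_chartField [CompleteSpace E] (V : SmoothVectorField E M) (x₀ : M) :
    ContDiffAt ℝ ∞ (chartField V x₀) (extChartAt 𝓘(ℝ, E) x₀ x₀) := by
  have h := VectorField.contMDiffWithinAt_mpullbackWithin_extChartAt_symm (n := ∞) (m := ∞)
    (s := univ) (I := 𝓘(ℝ, E)) (V := V) (x := x₀) (V.contMDiff x₀).contMDiffWithinAt
    uniqueMDiffOn_univ (mem_univ _) (by simp)
  rw [preimage_univ, inter_univ] at h
  exact contMDiffWithinAt_vectorSpace_iff_contDiffWithinAt.1 h |>.contDiffAt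
    (extChartAt_target_mem_nhds_self x₀)

theorem chartField_add (V W : SmoothVectorField E M) (x₀ : M) :
    chartField (V + W : SmoothVectorField E M) x₀ = chartField V x₀ + chartField W x₀ :=
  funext fun _ ↦ map_add _ _ _

theorem chartField_smul (c : ℝ) (V : SmoothVectorField E M) (x₀ : M) :
    chartField (c • V : SmoothVectorField E M) x₀ = c • chartField V x₀ :=
  funext fun _ ↦ map_smul _ _ _

/-- The function `x ↦ Ω_x(V₁ x, …, V_k x)`. -/
theorem eventuallyEq_inChart_comp {k : ℕ} (Ω : RawForm E M k)
    (V : Fin k → (x : M) → TangentSpace 𝓘(ℝ, E) x) (x₀ : M) :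
    (fun x ↦ Ω x fun i ↦ V i x) =ᶠ[𝓝 x₀]
      (fun y ↦ Ω.inChart x₀ y fun i ↦ chartField (V i) x₀ y) ∘ extChartAt 𝓘(ℝ, E) x₀ := by
  filter_upwards [extChartAt_source_mem_nhds (I := 𝓘(ℝ, E)) x₀] with x hx
  rw [Function.comp_apply, inChart_apply_chartField Ω ((extChartAt 𝓘(ℝ, E) x₀).map_source hx),
    (extChartAt 𝓘(ℝ, E) x₀).left_inv hx]

variable [CompleteSpace E]

theorem contMDiff_apply {k : ℕ} {Ω : RawForm E M k} (hΩ : Ω.IsSmooth)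
    (V : Fin k → SmoothVectorField E M) :
    ContMDiff 𝓘(ℝ, E) 𝓘(ℝ, ℝ) ∞ fun x ↦ Ω x fun i ↦ V i x := by
  intro x₀
  have h := contDiffAt_alternating_apply (hΩ.contDiffAt_inChart x₀)
    fun i ↦ contDiffAt_chartField (V i) x₀
  exact (h.contMDiffAt.comp x₀ contMDiffAt_extChartAt).congr_of_eventuallyEq
    (eventuallyEq_inChart_comp Ω (fun i ↦ V i) x₀)

/-- Near x₀ the function factors through the chart, whose derivative at x₀ is the identity; the
Leibniz rule in E does the rest. -/
theorem mvfderiv_apply {k : ℕ} {Ω : RawForm E M k} (hΩ : Ω.IsSmooth)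
    (V : Fin k → SmoothVectorField E M) (x₀ : M) (w : E) :
    mvfderiv 𝓘(ℝ, E) (fun x ↦ Ω x fun i ↦ V i x) x₀ w =
      fderiv ℝ (Ω.inChart x₀) (extChartAt 𝓘(ℝ, E) x₀ x₀) w (fun i ↦ (V i x₀ : E)) +
        ∑ i, Ω x₀ (Function.update (fun i ↦ (V i x₀ : E)) i
          (fderiv ℝ (chartField (V i) x₀) (extChartAt 𝓘(ℝ, E) x₀ x₀) w)) := by
  set y := extChartAt 𝓘(ℝ, E) x₀ x₀ with hy
  have hω : DifferentiableAt ℝ (Ω.inChart x₀) y :=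
    (hΩ.contDiffAt_inChart x₀).differentiableAt (by simp)
  have hV (i : Fin k) : DifferentiableAt ℝ (chartField (V i) x₀) y :=
    (contDiffAt_chartField (V i) x₀).differentiableAt (by simp)
  have h := fderiv_continuousAlternatingMap_apply_apply hω hV w
  have hF := (hω.continuousAlternatingMap_apply hV).mdifferentiableAt
  have hφ : MDifferentiableAt 𝓘(ℝ, E) 𝓘(ℝ, E) (extChartAt 𝓘(ℝ, E) x₀) x₀ :=
    mdifferentiableAt_extChartAt (mem_chart_source E x₀)
  have hm := mfderiv_comp (f := extChartAt 𝓘(ℝ, E) x₀) x₀ hF hφ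
  have he : mfderiv 𝓘(ℝ, E) 𝓘(ℝ, ℝ) (fun x ↦ Ω x fun i ↦ V i x) x₀ w =
      fderiv ℝ (fun z ↦ Ω.inChart x₀ z fun i ↦ chartField (V i) x₀ z) y w := by
    rw [(eventuallyEq_inChart_comp Ω (fun i ↦ V i) x₀).mfderiv_eq, hm, mfderiv_extChartAt_self,
      mfderiv_eq_fderiv]
    rfl
  have hs : (fun i ↦ chartField (V i) x₀ y) = fun i ↦ (V i x₀ : E) :=
    funext fun i ↦ chartField_self (V i) x₀
  rw [hs] at h
  exact (he.trans h).trans (congrArg _ (Finset.sum_congr rfl fun i _ ↦ inChart_self Ω x₀ _))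

end Chart

/-! ### The cochain of an action and its derivatives. -/

section Action

variable {E : Type*} [NormedAddCommGroup E] [NormedSpace ℝ E] [CompleteSpace E]
variable {M : Type*} [TopologicalSpace M] [ChartedSpace E M] [IsManifold 𝓘(ℝ, E) ∞ M]
variable {𝔤 : Type*} [LieRing 𝔤] [LieAlgebra ℝ 𝔤]

/-- The derivatives at `x₀`, in the preferred chart, of the vector fields of `ζ`. -/
def actionDeriv (ζ : 𝔤 →ₗ[ℝ] SmoothVectorField E M) (x₀ : M) : 𝔤 →ₗ[ℝ] E →ₗ[ℝ] E where
  toFun X := (fderiv ℝ (chartField (ζ X) x₀) (extChartAt 𝓘(ℝ, E) x₀ x₀)).toLinearMap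
  map_add' X Y := by
    rw [map_add, chartField_add, fderiv_add]
    · rfl
    · exact (contDiffAt_chartField (ζ X) x₀).differentiableAt (by simp)
    · exact (contDiffAt_chartField (ζ Y) x₀).differentiableAt (by simp)
  map_smul' c X := by
    rw [map_smul, chartField_smul, fderiv_const_smul_field]
    rfl

/-- The form `Ω` at `x₀`. -/
def formAt {k : ℕ} (Ω : RawForm E M k) (x₀ : M) : E [⋀^Fin k]→ₗ[ℝ] ℝ := (Ω x₀).toAlternatingMap

/-- The derivative of the form `Ω` at `x₀`, in the preferred chart. -/
def formDeriv {k : ℕ} (Ω : RawForm E M k) (x₀ : M) (w : E) : E [⋀^Fin k]→ₗ[ℝ] ℝ :=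
  (fderiv ℝ (Ω.inChart x₀) (extChartAt 𝓘(ℝ, E) x₀ x₀) w).toAlternatingMap

theorem IsNPlecticAction.isInvariantJet {n : ℕ} {Ω : RawForm E M (n + 1)}
    {ζ : 𝔤 →ₗ[ℝ] SmoothVectorField E M} (hζ : IsNPlecticAction Ω ζ) (hΩ : Ω.IsSmooth)
    (hd : Ω.d = 0) (x₀ : M) :
    IsInvariantJet (formAt Ω x₀) (formDeriv Ω x₀) (evalAt ζ x₀ : 𝔤 →ₗ[ℝ] E) (actionDeriv ζ x₀) := by
  have hclosed (u : Fin (n + 2) → E) :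
      ∑ i : Fin (n + 2), (-1) ^ (i : ℕ) • formDeriv Ω x₀ (u i) (i.removeNth u) = 0 := by
    have h := DFunLike.congr_fun (extDeriv_inChart_eq_zero (congrFun hd x₀)) u
    rw [extDeriv, ContinuousAlternatingMap.alternatizeUncurryFin_apply] at h
    exact h
  refine ⟨hclosed, fun X u ↦ ?_, fun X Y ↦ ?_⟩
  -- Since dΩ = 0, the Lie derivative reduces to d ι_{ζ(X)} Ω.
  · have hL : (Ω.contract (ζ X)).d x₀ = 0 := by
      have h := congrFun (hζ.preserves X) x₀
      rw [RawForm.lieDeriv, hd] at h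
      have h0 : RawForm.contract (ζ X) (0 : RawForm E M (n + 2)) x₀ = 0 := by
        ext u
        rfl
      exact (add_zero _).symm.trans ((congrArg _ h0.symm).trans h)
    have hV : DifferentiableAt ℝ (chartField (ζ X) x₀) (extChartAt 𝓘(ℝ, E) x₀ x₀) :=
      (contDiffAt_chartField (ζ X) x₀).differentiableAt (by simp)
    have h := extDeriv_inChart_contract_apply hΩ hV u
    rw [extDeriv_inChart_eq_zero hL] at h
    exact invariant_of_closed_contract hclosed (ζ X x₀ : E) (actionDeriv ζ x₀ X) u h.symm
  · exact (hζ.map_lie X Y x₀).trans ((lieBracket_chartField (ζ X) (ζ Y) x₀).trans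
      (congrArg₂ (fun a b : E ↦ actionDeriv ζ x₀ Y a - actionDeriv ζ x₀ X b)
        (chartField_self (ζ X) x₀) (chartField_self (ζ Y) x₀)))

/-- The cochain `(Y₀, …, Yₙ) ↦ Ω(ζ Y₀, …, ζ Yₙ)` at `x`. -/
def actionCochain {k : ℕ} (Ω : RawForm E M k) (ζ : 𝔤 →ₗ[ℝ] SmoothVectorField E M) (x : M) :
    𝔤 [⋀^Fin k]→ₗ[ℝ] ℝ :=
  (formAt Ω x).compLinearMap (evalAt ζ x : 𝔤 →ₗ[ℝ] E)

theorem contMDiff_actionCochain {k : ℕ} {Ω : RawForm E M k} (hΩ : Ω.IsSmooth)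
    (ζ : 𝔤 →ₗ[ℝ] SmoothVectorField E M) (Y : Fin k → 𝔤) :
    ContMDiff 𝓘(ℝ, E) 𝓘(ℝ, ℝ) ∞ fun x ↦ actionCochain Ω ζ x Y :=
  contMDiff_apply hΩ fun i ↦ ζ (Y i)

theorem mvfderiv_actionCochain {k : ℕ} {Ω : RawForm E M k} (hΩ : Ω.IsSmooth)
    (ζ : 𝔤 →ₗ[ℝ] SmoothVectorField E M) (Y : Fin k → 𝔤) (x : M) (w : E) :
    mvfderiv 𝓘(ℝ, E) (fun x ↦ actionCochain Ω ζ x Y) x w =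
      formDeriv Ω x w (fun i ↦ (evalAt ζ x (Y i) : E)) +
        ∑ l, formAt Ω x (Function.update (fun i ↦ (evalAt ζ x (Y i) : E)) l
          (actionDeriv ζ x (Y l) w)) :=
  mvfderiv_apply hΩ (fun i ↦ ζ (Y i)) x w

omit [CompleteSpace E] [IsManifold 𝓘(ℝ, E) ∞ M] in
theorem mvfderiv_sum_mul {ι : Type*} {s : Finset ι} (a : ι → ℝ) {f : ι → M → ℝ}
    (hf : ∀ i, ContMDiff 𝓘(ℝ, E) 𝓘(ℝ, ℝ) ∞ (f i)) (x : M) (w : TangentSpace 𝓘(ℝ, E) x) :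
    mvfderiv 𝓘(ℝ, E) (fun x ↦ ∑ i ∈ s, a i * f i x) x w =
      ∑ i ∈ s, a i * mvfderiv 𝓘(ℝ, E) (f i) x w := by
  classical
  have hc (i : ι) : ContMDiff 𝓘(ℝ, E) 𝓘(ℝ, ℝ) ∞ fun x ↦ a i * f i x :=
    contMDiff_const.mul (hf i)
  induction s using Finset.induction_on with
  | empty => simp [mvfderiv_const]
  | insert i s hi ih =>
    have hs : ContMDiff 𝓘(ℝ, E) 𝓘(ℝ, ℝ) ∞ fun x ↦ ∑ i ∈ s, a i * f i x :=
      contMDiff_finsetSum fun i _ ↦ hc i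
    simp only [Finset.sum_insert hi]
    rw [mvfderiv_fun_add ((hc i).contMDiffAt.mdifferentiableAt (by simp))
      (hs.contMDiffAt.mdifferentiableAt (by simp)), ← ih, mvfderiv_fun_mul mdifferentiableAt_const
      ((hf i).contMDiffAt.mdifferentiableAt (by simp)), mvfderiv_const]
    simp

section LinearFunctional

variable [Module.Finite ℝ 𝔤] {k : ℕ} {Ω : RawForm E M k}

/-- By `exists_eq_sum_eval` only finitely many scalar functions x ↦ φ_x(Y) are involved, so no
topology on the space of cochains is needed. -/
theorem contMDiff_linearFunctional_actionCochain (hΩ : Ω.IsSmooth)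
    (ζ : 𝔤 →ₗ[ℝ] SmoothVectorField E M) (ℓ : (𝔤 [⋀^Fin k]→ₗ[ℝ] ℝ) →ₗ[ℝ] ℝ) :
    ContMDiff 𝓘(ℝ, E) 𝓘(ℝ, ℝ) ∞ fun x ↦ ℓ (actionCochain Ω ζ x) := by
  obtain ⟨ι, _, a, e, hℓ⟩ := exists_eq_sum_eval ℓ
  simp only [hℓ]
  exact contMDiff_finsetSum fun i _ ↦
    (contMDiff_const (c := a i)).mul (contMDiff_actionCochain hΩ ζ (e i))

theorem mvfderiv_linearFunctional_actionCochain (hΩ : Ω.IsSmooth)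
    (ζ : 𝔤 →ₗ[ℝ] SmoothVectorField E M) (ℓ : (𝔤 [⋀^Fin k]→ₗ[ℝ] ℝ) →ₗ[ℝ] ℝ) (x : M)
    (w : TangentSpace 𝓘(ℝ, E) x) (f : 𝔤 [⋀^Fin k]→ₗ[ℝ] ℝ)
    (hf : ∀ Y, mvfderiv 𝓘(ℝ, E) (fun x ↦ actionCochain Ω ζ x Y) x w = f Y) :
    mvfderiv 𝓘(ℝ, E) (fun x ↦ ℓ (actionCochain Ω ζ x)) x w = ℓ f := by
  obtain ⟨ι, _, a, e, hℓ⟩ := exists_eq_sum_eval ℓ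
  simp only [hℓ]
  rw [mvfderiv_sum_mul a (fun i ↦ contMDiff_actionCochain hΩ ζ (e i))]
  simp only [hf]

end LinearFunctional

end Action

/-! ### Construction of the multi-moment map. -/

section MomentMap

variable {E : Type*} [NormedAddCommGroup E] [NormedSpace ℝ E]
variable {M : Type*} [TopologicalSpace M] [ChartedSpace E M] [IsManifold 𝓘(ℝ, E) ∞ M]
variable {𝔤 : Type*} [LieRing 𝔤] [LieAlgebra ℝ 𝔤]

/-- The cochain `(Y₁, …, Yₙ) ↦ Ω(ζ Y₁, …, ζ Yₙ, w)`. -/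
def contractCochain {n : ℕ} (Ω : RawForm E M (n + 1)) (ζ : 𝔤 →ₗ[ℝ] SmoothVectorField E M) (x : M)
    (w : TangentSpace 𝓘(ℝ, E) x) : 𝔤 [⋀^Fin n]→ₗ[ℝ] ℝ :=
  (LinearMap.applyₗ w).compAlternatingMap ((Ω.contractMulti x).compLinearMap (evalAt ζ x))

theorem contractExt_apply {n : ℕ} (Ω : RawForm E M (n + 1)) (ζ : 𝔤 →ₗ[ℝ] SmoothVectorField E M)
    (x : M) (p : ⋀[ℝ]^n 𝔤) (w : TangentSpace 𝓘(ℝ, E) x) :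
    contractExt Ω ζ x p w =
      exteriorPower.alternatingMapLinearEquiv (contractCochain Ω ζ x w) p := by
  have h : LinearMap.applyₗ w ∘ₗ contractExt Ω ζ x =
      exteriorPower.alternatingMapLinearEquiv (contractCochain Ω ζ x w) := by
    refine exteriorPower.linearMap_ext ?_
    ext Y
    simp [contractExt, contractCochain, -exteriorPower.ιMulti_apply_coe]
  exact LinearMap.congr_fun h p

theorem curryLeft_formAt_compLinearMap {n : ℕ} (Ω : RawForm E M (n + 1))
    (ζ : 𝔤 →ₗ[ℝ] SmoothVectorField E M) (x : M) (w : TangentSpace 𝓘(ℝ, E) x) :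
    ((formAt Ω x).curryLeft w).compLinearMap (evalAt ζ x : 𝔤 →ₗ[ℝ] E) =
      (-1 : ℝ) ^ n • contractCochain Ω ζ x w := by
  ext Y
  exact curryLeft_eq_map_snoc (formAt Ω x) (fun k ↦ (evalAt ζ x (Y k) : E)) w

variable [CompleteSpace E] [Module.Finite ℝ 𝔤]

theorem exists_isMultiMomentMap {m : ℕ} {Ω : RawForm E M (m + 2)} (hΩ : Ω.IsSmooth) (hd : Ω.d = 0)
    {ζ : 𝔤 →ₗ[ℝ] SmoothVectorField E M} (hζ : IsNPlecticAction Ω ζ)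
    (h₁ : Subsingleton (LieCohomology 𝔤 ℝ (m + 1)))
    (h₂ : Subsingleton (LieCohomology 𝔤 ℝ (m + 2))) :
    ∃ v : M → Module.Dual ℝ (lieKernel 𝔤 (m + 1)), IsMultiMomentMap Ω ζ v := by
  -- A single B serves all points, so the moment map is a fixed linear image of φ_x and inherits its
  -- smoothness.
  obtain ⟨B, hB⟩ := exists_linearMap_quasiInverse
    (ceDiff (m + 1) : (𝔤 [⋀^Fin (m + 1)]→ₗ[ℝ] ℝ) →ₗ[ℝ] _)
  let ev (p : ⋀[ℝ]^(m + 1) 𝔤) : (𝔤 [⋀^Fin (m + 1)]→ₗ[ℝ] ℝ) →ₗ[ℝ] ℝ :=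
    LinearMap.applyₗ p ∘ₗ exteriorPower.alternatingMapLinearEquiv.toLinearMap
  have hev (f : 𝔤 [⋀^Fin (m + 1)]→ₗ[ℝ] ℝ) (p : ⋀[ℝ]^(m + 1) 𝔤) :
      ev p f = exteriorPower.alternatingMapLinearEquiv f p := rfl
  -- Here n = m + 1: the minus sign of `deriv_apply` times (-1)ⁿ from moving w to the last slot.
  let ε : ℝ := (-1) ^ m
  have hε : ε * ε = 1 := by rw [← mul_pow, neg_mul_neg, one_mul, one_pow]
  let ℓ (p : ⋀[ℝ]^(m + 1) 𝔤) : (𝔤 [⋀^Fin (m + 2)]→ₗ[ℝ] ℝ) →ₗ[ℝ] ℝ := ε • (ev p ∘ₗ B)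
  have hℓ (p : ⋀[ℝ]^(m + 1) 𝔤) (hp : p ∈ lieKernel 𝔤 (m + 1)) (f : 𝔤 [⋀^Fin (m + 1)]→ₗ[ℝ] ℝ) :
      ℓ p (ceDiff (m + 1) f) = ε * exteriorPower.alternatingMapLinearEquiv f p := by
    -- Bδf − f is an n-cocycle, hence vanishes on the Lie kernel: the choice of B is invisible
    -- there.
    have h := alternatingMapLinearEquiv_eq_zero_of_mem_lieKernel h₁
      (f := B (ceDiff (m + 1) f) - f) (by rw [map_sub, hB, sub_self]) hp
    rw [map_sub, LinearMap.sub_apply, sub_eq_zero] at h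
    rw [← h]
    rfl
  have hjet := hζ.isInvariantJet hΩ hd
  refine ⟨fun x ↦
    { toFun p := ℓ p (actionCochain Ω ζ x)
      map_add' p q := ?_
      map_smul' c p := ?_ }, fun p ↦ ?_, fun p x w ↦ ?_, fun X p x ↦ ?_⟩
  · change ε * _ = ε * _ + ε * _
    simp only [LinearMap.comp_apply, hev, Submodule.coe_add, map_add, mul_add]
  · change ε * _ = c * (ε * _)
    simp only [LinearMap.comp_apply, hev, Submodule.coe_smul, map_smul, smul_eq_mul]
    ring
  · exact contMDiff_linearFunctional_actionCochain hΩ ζ (ℓ p)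
  · have hw (Y : Fin (m + 2) → 𝔤) : mvfderiv 𝓘(ℝ, E) (fun x ↦ actionCochain Ω ζ x Y) x w =
        ceDiff (m + 1) (ε • contractCochain Ω ζ x w) Y := by
      refine (mvfderiv_actionCochain hΩ ζ Y x w).trans (((hjet x).deriv_apply w Y).trans ?_)
      rw [curryLeft_formAt_compLinearMap, map_smul, map_smul, AlternatingMap.smul_apply,
        AlternatingMap.smul_apply, smul_eq_mul, smul_eq_mul, pow_succ, mul_neg_one, neg_mul, neg_neg]
    refine (mvfderiv_linearFunctional_actionCochain hΩ ζ (ℓ p) x w _ hw).trans ?_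
    rw [hℓ p p.2, contractExt_apply, map_smul, LinearMap.smul_apply, smul_eq_mul, ← mul_assoc, hε,
      one_mul]
  · have hX (Y : Fin (m + 2) → 𝔤) :
        mvfderiv 𝓘(ℝ, E) (fun x ↦ actionCochain Ω ζ x Y) x (ζ X x) =
        derivAlt (LieAlgebra.ad ℝ 𝔤 X) (actionCochain Ω ζ x) Y :=
      (mvfderiv_actionCochain hΩ ζ Y x (ζ X x)).trans ((hjet x).deriv_along X Y)
    refine Eq.trans ?_ (mvfderiv_linearFunctional_actionCochain hΩ ζ (ℓ p) x _ _ hX).symm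
    -- Vanishing in degree n + 1 enters only here. The primitive b is chosen at the one point x, so
    -- no regularity in x is required. Both sides then become ε times the pairing of p with the
    -- ad_X-derivative of b.
    obtain ⟨b, hb⟩ := exists_ceDiff_eq h₂ (hjet x).ceDiff_eq_zero
    change ceDiff (m + 1) b = actionCochain Ω ζ x at hb
    change ℓ (adExt (m + 1) X p) _ = _
    rw [← hb, ← ceDiff_derivAlt, hℓ _ p.2, hℓ _ (adExt_mem_lieKernel X p.2),
      alternatingMapLinearEquiv_adExt]

end MomentMap

end

end MultiMoment

/-- Let `(M, Ω)` be an `n`-plectic manifold with an infinitesimal `n`-plectic action of a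
finite-dimensional Lie algebra `𝔤`. If `Hⁿ(𝔤) = Hⁿ⁺¹(𝔤) = 0`, then a multi-moment map exists. -/
theorem mainTheorem4
    {E : Type*} [NormedAddCommGroup E] [NormedSpace ℝ E] [FiniteDimensional ℝ E]
    {M : Type*} [TopologicalSpace M] [ChartedSpace E M] [IsManifold 𝓘(ℝ, E) ∞ M]
    {𝔤 : Type*} [LieRing 𝔤] [LieAlgebra ℝ 𝔤] [Module.Finite ℝ 𝔤]
    (n : ℕ) (Ω : MultiMoment.RawForm E M (n + 1)) (hΩ : MultiMoment.IsNPlectic E M n Ω)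
    (ζ : 𝔤 →ₗ[ℝ] MultiMoment.SmoothVectorField E M) (hζ : MultiMoment.IsNPlecticAction Ω ζ)
    (hn : Subsingleton (MultiMoment.LieCohomology 𝔤 ℝ n))
    (hn' : Subsingleton (MultiMoment.LieCohomology 𝔤 ℝ (n + 1))) :
    ∃ v : M → Module.Dual ℝ (MultiMoment.lieKernel 𝔤 n), MultiMoment.IsMultiMomentMap Ω ζ v := by
  cases n with
  | zero => exact absurd hn MultiMoment.not_subsingleton_lieCohomology_zero
  | succ m =>
    have := FiniteDimensional.complete ℝ E
    exact MultiMoment.exists_isMultiMomentMap hΩ.smooth hΩ.closed hζ hn hn'
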